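/- Call two databases $\boldsymbol X,\boldsymbol Y\in\mathcal X^n$ neighbors if their Hamming distance is at most $1$. For a query $f:\mathcal X^n\to\mathbb R$ let $\phi(f)=\sup|f(\boldsymbol X)-f(\boldsymbol Y)|$ over neighbors be its sensitivity. A randomized mechanism $h$ is $(\varepsilon,\eta)$-differentially private if $\mathbb P(h(\boldsymbol X)\in B)\le e^{\varepsilon}\,\mathbb P(h(\boldsymbol Y)\in B)+\eta$ for all neighbors $\boldsymbol X,\boldsymbol Y$ and all Borel sets $B\subseteq\mathbb R$; its accuracy for $f$ is $\sup_{\boldsymbol X}\sqrt{\mathbb E[(h(\boldsymbol X)-f(\boldsymbol X))^2]}$. Let $\mathsf d_{\mathsf{TV}}$ be the total variation distance $\sup_B|\mu(B)-\nu(B)|$ between laws. Running times are counted at unit cost per instruction for programs on real registers: rational constants, the four arithmetic operations, $\sqrt{\cdot}$, $\exp$, $\log$, comparison and conditional jumps, and fresh independent samples from $\mathsf{Unif}[0,1]$ and from $\mathcal N(0,1)$. There are a program and a polynomial $p$ such that the following holds for all $b>0$ and $\delta\in(0,1)$. On input $(\delta,b,x)$, $x\in\mathbb R$, the program always halts within $p(1/\delta)$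 steps, and its output is distributed according to $K(\cdot\,|\,x)$ for a Markov kernel $K=K_{\delta,b}$ on $\mathbb R$. For every set $\mathcal X$, every $n$ and every query $f:\mathcal X^n\to\mathbb R$, let $g(\boldsymbol X)=f(\boldsymbol X)+\xi$ with $\xi\sim\mathsf{Lap}(0,b)$ be the Laplace mechanism, and let $h(\boldsymbol X)\sim K(\cdot\,|\,g(\boldsymbol X))$ be the output of the program on input $(\delta,b,g(\boldsymbol X))$ (so $h$ is constructed purely from $g(\boldsymbol X)$, without access to $f$ or $\boldsymbol X$). Then: 1. for every $\boldsymbol X\in\mathcal X^n$, $\mathsf d_{\mathsf{TV}}\big(h(\boldsymbol X),\,f(\boldsymbol X)+Z\big)\le\delta$, where $Z\sim\mathcal N\big(0,2b^2\log(12/\delta)\big)$; 2. if $\phi(f)<\infty$, then $h$ is $\big(\phi(f)/b,\,0\big)$-differentially private; 3. the accuracy of $h$ for $f$ is at most $$\sqrt{2b^2\log(12/\delta)+2b^2+\frac{b^2}{4}\,\delta\,\log^{3/2}(12/\delta)}.$$ -/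

import Mathlib

open MeasureTheory ProbabilityTheory

namespace LaplaceToGauss

noncomputable section

/-! ### Mechanisms, sensitivity, privacy, accuracy -/

/-- A real-valued (randomized) mechanism on databases in `𝒳ⁿ`, given by the law of its output
on each database. -/
abbrev Mechanism (𝒳 : Type*) (n : ℕ) := (Fin n → 𝒳) → Measure ℝ

open Classical in
/-- Two databases are neighbors if their Hamming distance is at most one. -/
def Neighbors {𝒳 : Type*} {n : ℕ} (X Y : Fin n → 𝒳) : Prop := hammingDist X Y ≤ 1

/-- The set of all values `|f X - f Y|` over neighboring databases. -/
def neighborGaps {𝒳 : Type*} {n : ℕ} (f : (Fin n → 𝒳) → ℝ) : Set ℝ :=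
  {r | ∃ X Y : Fin n → 𝒳, Neighbors X Y ∧ r = |f X - f Y|}

/-- The query has finite sensitivity. -/
def FiniteSensitivity {𝒳 : Type*} {n : ℕ} (f : (Fin n → 𝒳) → ℝ) : Prop :=
  BddAbove (neighborGaps f)

/-- The sensitivity of a query (meaningful when it is finite). -/
def sensitivity {𝒳 : Type*} {n : ℕ} (f : (Fin n → 𝒳) → ℝ) : ℝ := sSup (neighborGaps f)

/-- `(ε, η)` differential privacy. -/
def IsDifferentiallyPrivate {𝒳 : Type*} {n : ℕ} (M : Mechanism 𝒳 n) (ε η : ℝ) : Prop :=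
  ∀ X Y : Fin n → 𝒳, Neighbors X Y → ∀ B : Set ℝ, MeasurableSet B →
    (M X).real B ≤ Real.exp ε * (M Y).real B + η

/-- The `ℓ₂` accuracy `sup_X √(𝔼 (M(X) - f(X))²)` of a mechanism for the query `f`, as an
extended nonnegative real number. -/
def accuracy {𝒳 : Type*} {n : ℕ} (M : Mechanism 𝒳 n) (f : (Fin n → 𝒳) → ℝ) : ENNReal :=
  ⨆ X : Fin n → 𝒳, (∫⁻ y, ENNReal.ofReal ((y - f X) ^ 2) ∂(M X)) ^ (1 / 2 : ℝ)

/-- The Laplace distribution with mean `θ` and scale `b`. -/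
def laplaceMeasure (θ b : ℝ) : Measure ℝ :=
  volume.withDensity fun x => ENNReal.ofReal (1 / (2 * b) * Real.exp (-|x - θ| / b))

/-- The Laplace mechanism: the law of `f X + ξ` with `ξ ∼ Lap(0, b)`. -/
def laplaceMechanism {𝒳 : Type*} {n : ℕ} (f : (Fin n → 𝒳) → ℝ) (b : ℝ) : Mechanism 𝒳 n :=
  fun X => (laplaceMeasure 0 b).map fun z => f X + z

/-- The Gaussian mechanism: the law of `f X + Z` with `Z ∼ N(0, v)`. -/
def gaussianMechanism {𝒳 : Type*} {n : ℕ} (f : (Fin n → 𝒳) → ℝ) (v : ℝ) : Mechanism 𝒳 n :=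
  fun X => (gaussianReal 0 v.toNNReal).map fun z => f X + z

/-- The post-processing of a mechanism by a Markov kernel: the law of a draw from `K(· | y)`,
where `y` is the output of the mechanism. -/
def Mechanism.followedBy {𝒳 : Type*} {n : ℕ} (M : Mechanism 𝒳 n) (K : Kernel ℝ ℝ) :
    Mechanism 𝒳 n :=
  fun X => (M X).bind K

/-- Total variation distance between probability measures, `sup_B |μ(B) - ν(B)|`. -/
def tvDist (μ ν : Measure ℝ) : ℝ :=
  ⨆ B : {B : Set ℝ // MeasurableSet B}, |μ.real B.1 - ν.real B.1|

/-! ### Randomized computation with real arithmetic at unit cost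

A program is a finite list of instructions acting on real registers. Every instruction costs one
unit of time. At each time step a fresh pair consisting of a uniform number in `[0, 1]` and an
independent standard Gaussian number is available to the sampling instructions. -/

/-- Instructions; the first argument of an arithmetic or sampling instruction is the register in
which the result is stored. -/
inductive Instr
  | const (d : ℕ) (q : ℚ)
  | add (d i j : ℕ)
  | sub (d i j : ℕ)
  | mul (d i j : ℕ)
  | div (d i j : ℕ)
  | sqrt (d i : ℕ)
  | exp (d i : ℕ)
  | log (d i : ℕ)
  | unif (d : ℕ)
  | gauss (d : ℕ)
  /-- jump to instruction `t` if register `i` is at most register `j` -/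
  | jumpLe (i j t : ℕ)

abbrev Program := List Instr

/-- A configuration: the position in the program and the contents of the registers. -/
structure Config where
  pos : ℕ
  reg : ℕ → ℝ

/-- Store `v` in register `d` and move on to the next instruction. -/
def Config.store (c : Config) (d : ℕ) (v : ℝ) : Config :=
  ⟨c.pos + 1, Function.update c.reg d v⟩

/-- Execution of one instruction, where `r` is the fresh pair of random numbers. -/
def Instr.exec (r : ℝ × ℝ) (c : Config) : Instr → Config
  | .const d q => c.store d q
  | .add d i j => c.store d (c.reg i + c.reg j)
  | .sub d i j => c.store d (c.reg i - c.reg j)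
  | .mul d i j => c.store d (c.reg i * c.reg j)
  | .div d i j => c.store d (c.reg i / c.reg j)
  | .sqrt d i => c.store d (Real.sqrt (c.reg i))
  | .exp d i => c.store d (Real.exp (c.reg i))
  | .log d i => c.store d (Real.log (c.reg i))
  | .unif d => c.store d r.1
  | .gauss d => c.store d r.2
  | .jumpLe i j t =>
    open Classical in if c.reg i ≤ c.reg j then ⟨t, c.reg⟩ else ⟨c.pos + 1, c.reg⟩

/-- The program has halted when the position lies beyond its last instruction. -/
def Program.Halted (P : Program) (c : Config) : Prop := P.length ≤ c.pos

/-- One time step of a program; a halted configuration does not change. -/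
def Program.step (P : Program) (r : ℝ × ℝ) (c : Config) : Config :=
  match P[c.pos]? with
  | some i => i.exec r c
  | none => c

/-- The sequence of random numbers used by a run: one pair for every time step. -/
abbrev RandomTape := ℕ → ℝ × ℝ

/-- The configuration after `t` time steps. -/
def Program.run (P : Program) (ω : RandomTape) (c : Config) : ℕ → Config
  | 0 => c
  | t + 1 => P.step (ω t) (P.run ω c t)

/-- The initial configuration: the input stands in the first registers, the others hold `0`. -/
def initial (input : List ℝ) : Config := ⟨0, fun i => input.getD i 0⟩

/-- The law of the random tape: independent pairs of independent `Unif[0, 1]` and `N(0, 1)`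
random variables. -/
def tapeLaw : Measure RandomTape :=
  Measure.infinitePi fun _ : ℕ => (volume.restrict (Set.Icc (0 : ℝ) 1)).prod (gaussianReal 0 1)

/-- On the given input the program halts, for every random tape, after at most `T` time steps, and
its output (the final content of register `0`) is a random variable with law `μ`. -/
def Program.SamplesWithin (P : Program) (input : List ℝ) (μ : Measure ℝ) (T : ℝ) : Prop :=
  ∃ out : RandomTape → ℝ, Measurable out ∧
    (∀ ω, ∃ t : ℕ, (t : ℝ) ≤ T ∧ P.Halted (P.run ω (initial input) t) ∧
      (P.run ω (initial input) t).reg 0 = out ω) ∧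
    tapeLaw.map out = μ

end

end LaplaceToGauss

namespace LaplaceToGauss

/-! ### The rejection sampler as a program -/

/-! Put L = log (12 / δ), β = √(2L), a = β² + 1, and measure lengths in units of bβ. The target is
then the standard Gaussian with density φ, and the Laplace noise has scale 1/β. Its density is the
Green's function of 1 - β⁻²D², so adding that noise to the signed density φ - β⁻²φ'' = β⁻²(a - t²)φ
gives back φ exactly (`integral_gaussian_laplace_kernel`, `integral_laplace_smoothing`).

The positive part of this signed density is, up to a constant, max(1 - t²/a, 0) φ: a Gaussian
proposal t accepted with probability max(1 - t²/a, 0). Two errors arise. For (1 - t²/a) φ the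
discarded negative part has mass at most 2 exp(-L) = δ/6 (`integral_negPart_le`). A round fails with
probability at most 1/a ≤ 1/5, so after more than 12/δ rounds the chance of no acceptance is at most
δ/12. `abs_integral_samplerLaw_sub_le` combines them, and the total variation is at most (5/2)(δ/12)
+ δ/12 ≤ δ.

Privacy is that of the Laplace mechanism, preserved by post-processing. For accuracy, acceptance
favours small |t|, so the sampler has second moment at most 1, and the mean square error is at most
2b² + (bβ)². -/

/-- The program that reads `δ, b, x` and computes `x + b √(2L) r` with `L = log (12 / δ)`, where `r`
is the last of the standard Gaussian proposals `t` accepted by the test `u a + t² ≤ a` with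
`a = 2L + 1` and `u` uniform. The loop body takes nine steps, whichever way the test goes. -/
def rejectionProgram : Program :=
  [.const 4 1, .const 3 12, .div 6 3 0, .log 3 6, .add 3 3 3, .add 8 3 4, .sqrt 3 3, .mul 1 1 3,
   .gauss 9, .unif 10, .mul 10 10 8, .mul 11 9 9, .add 10 10 11,
   -- Register 12 is never written and holds 0: comparing it with itself is an unconditional jump,
   -- and adding it copies a register.
   .jumpLe 10 8 15, .jumpLe 12 12 16, .add 7 9 12, .add 5 5 4, .jumpLe 5 6 8,
   .mul 7 1 7, .add 0 2 7]

open Classical in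
/-- The last proposal accepted in the first `k` rounds, and `0` if there is none. -/
noncomputable def lastAccepted (a : ℝ) (ω : RandomTape) : ℕ → ℝ
  | 0 => 0
  -- Rounds are numbered from 0. Eight steps of set-up precede the loop, so round k draws its
  -- Gaussian at time 8 + 9k and its uniform one step later.
  | k + 1 => if (ω (8 + 9 * k + 1)).1 * a + (ω (8 + 9 * k)).2 * (ω (8 + 9 * k)).2 ≤ a
      then (ω (8 + 9 * k)).2 else lastAccepted a ω k

theorem Program.run_add (P : Program) (ω : RandomTape) (c : Config) (s t : ℕ) :
    P.run ω c (s + t) = P.run (fun i => ω (s + i)) (P.run ω c s) t := by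
  induction t with
  | zero => rfl
  | succ t ih => rw [← Nat.add_assoc, Program.run, ih, Program.run]

/-- The contents of the registers at the head of the loop, after `k` rounds. -/
structure LoopInvariant (σ a m x r : ℝ) (k : ℕ) (c : Config) : Prop where
  pos : c.pos = 8
  scale : c.reg 1 = σ
  input : c.reg 2 = x
  one : c.reg 4 = 1
  counter : c.reg 5 = k
  limit : c.reg 6 = m
  result : c.reg 7 = r
  bound : c.reg 8 = a
  zero : c.reg 12 = 0

theorem rejectionProgram_init (δ b x : ℝ) (ω : RandomTape) :
    LoopInvariant (b * √(2 * Real.log (12 / δ))) (2 * Real.log (12 / δ) + 1) (12 / δ) x 0 0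
      (rejectionProgram.run ω (initial [δ, b, x]) 8) := by
  constructor <;>
  simp [Program.run, Program.step, rejectionProgram, Instr.exec, Config.store, initial,
    Function.update, two_mul]

open Classical in
-- On rejection an extra jump replaces the copying of the proposal, so both branches cost the same
-- and the tape entries read by each round do not depend on the past. Leaving the loop costs two
-- further steps for the rescaling and the shift by x.
theorem rejectionProgram_body {σ a m x r : ℝ} {k : ℕ} {c : Config} (ω : RandomTape)
    (h : LoopInvariant σ a m x r k c) :
    let r' := if (ω 1).1 * a + (ω 0).2 * (ω 0).2 ≤ a then (ω 0).2 else r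
    if (k + 1 : ℕ) ≤ m then LoopInvariant σ a m x r' (k + 1) (rejectionProgram.run ω c 9)
    else rejectionProgram.Halted (rejectionProgram.run ω c 11) ∧
      (rejectionProgram.run ω c 11).reg 0 = x + σ * r' := by
  obtain ⟨pos, reg⟩ := c
  obtain ⟨h0, h1, h2, h4, h5, h6, h7, h8, h12⟩ := h
  dsimp only at h0 h1 h2 h4 h5 h6 h7 h8 h12
  subst h0
  intro r'
  by_cases hacc : (ω 1).1 * a + (ω 0).2 * (ω 0).2 ≤ a <;>
  by_cases hk : (k : ℝ) + 1 ≤ m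
  all_goals simp only [Nat.cast_add, Nat.cast_one, hk, if_true, if_false]
  · constructor <;>
    simp [Program.run, Program.step, rejectionProgram, Instr.exec, Config.store,
      Function.update, h1, h2, h4, h5, h6, h8, h12, hacc, hk, r']
  · constructor <;>
    simp [Program.run, Program.step, rejectionProgram, Instr.exec, Config.store, Program.Halted,
      Function.update, h1, h2, h4, h5, h6, h8, h12, hacc, hk, r']
  · constructor <;>
    simp [Program.run, Program.step, rejectionProgram, Instr.exec, Config.store,
      Function.update, h1, h2, h4, h5, h6, h7, h8, h12, hacc, hk, r']
  · constructor <;>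
    simp [Program.run, Program.step, rejectionProgram, Instr.exec, Config.store, Program.Halted,
      Function.update, h1, h2, h4, h5, h6, h7, h8, h12, hacc, hk, r']

theorem rejectionProgram_loop (δ b x : ℝ) (ω : RandomTape) (k : ℕ)
    (hk : (k : ℝ) ≤ 12 / δ) :
    LoopInvariant (b * √(2 * Real.log (12 / δ))) (2 * Real.log (12 / δ) + 1) (12 / δ) x
      (lastAccepted (2 * Real.log (12 / δ) + 1) ω k) k
      (rejectionProgram.run ω (initial [δ, b, x]) (8 + 9 * k)) := by
  induction k with
  | zero => exact rejectionProgram_init δ b x ω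
  | succ k ih =>
    have h := ih (le_trans (by simp) hk)
    have h' := rejectionProgram_body (fun i => ω (8 + 9 * k + i)) h
    rw [if_pos hk] at h'
    rw [Nat.mul_succ, ← Nat.add_assoc, Program.run_add]
    exact h'

/-- The number of rounds made by the program. -/
noncomputable def rounds (δ : ℝ) : ℕ := ⌊12 / δ⌋₊ + 1

theorem rejectionProgram_halts (δ b x : ℝ) (hδ : 0 < δ) (ω : RandomTape) :
    ∃ t : ℕ, (t : ℝ) ≤ 108 * (1 / δ) + 19 ∧
      rejectionProgram.Halted (rejectionProgram.run ω (initial [δ, b, x]) t) ∧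
      (rejectionProgram.run ω (initial [δ, b, x]) t).reg 0 =
        x + b * √(2 * Real.log (12 / δ)) *
          lastAccepted (2 * Real.log (12 / δ) + 1) ω (rounds δ) := by
  have hfl : (⌊12 / δ⌋₊ : ℝ) ≤ 12 / δ := Nat.floor_le (by positivity)
  have h := rejectionProgram_body (fun i => ω (8 + 9 * ⌊12 / δ⌋₊ + i))
    (rejectionProgram_loop δ b x ω _ hfl)
  -- The counter is tested after its increment, so the round starting from counter ⌊12/δ⌋ is the
  -- last; this is the + 1 in `rounds`.
  rw [if_neg (not_le.2 (by exact_mod_cast Nat.lt_floor_add_one (12 / δ)))] at h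
  refine ⟨8 + 9 * ⌊12 / δ⌋₊ + 11, ?_, ?_⟩
  · push_cast
    have : 12 / δ = 12 * (1 / δ) := by ring
    linarith
  · rw [Program.run_add]
    exact h

theorem measurable_lastAccepted (a : ℝ) (k : ℕ) : Measurable fun ω => lastAccepted a ω k := by
  induction k with
  | zero => exact measurable_const
  | succ k ih =>
    refine Measurable.ite (measurableSet_le ?_ measurable_const) ?_ ih <;> fun_prop

/-! ### The law of the output -/

/-- The law of an accepted Gaussian proposal, of total mass the acceptance probability. -/
noncomputable def acceptedMeasure (a : ℝ) : Measure ℝ :=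
  (gaussianReal 0 1).withDensity fun t => ENNReal.ofReal (1 - t ^ 2 / a)

/-- The law of the last accepted proposal in `k` rounds. -/
noncomputable def samplerLaw (a : ℝ) : ℕ → Measure ℝ
  | 0 => Measure.dirac 0
  | k + 1 => acceptedMeasure a + (1 - acceptedMeasure a Set.univ) • samplerLaw a k

/-- The uniform law on the unit interval. -/
noncomputable abbrev unifLaw : Measure ℝ := volume.restrict (Set.Icc (0 : ℝ) 1)

instance : IsProbabilityMeasure unifLaw := ⟨by simp⟩

instance : IsProbabilityMeasure tapeLaw := by unfold tapeLaw; infer_instance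

theorem acceptedMeasure_le {a : ℝ} (ha : 0 < a) : acceptedMeasure a Set.univ ≤ 1 := by
  rw [acceptedMeasure, withDensity_apply _ MeasurableSet.univ, Measure.restrict_univ]
  calc _ ≤ ∫⁻ _, 1 ∂(gaussianReal 0 1) := by
        refine lintegral_mono fun t => ENNReal.ofReal_le_one.2 ?_
        have : 0 ≤ t ^ 2 / a := by positivity
        linarith
    _ = 1 := by simp

theorem isProbabilityMeasure_samplerLaw {a : ℝ} (ha : 0 < a) (k : ℕ) :
    IsProbabilityMeasure (samplerLaw a k) := by
  induction k with
  | zero => unfold samplerLaw; infer_instance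
  | succ k ih =>
    constructor
    simp [samplerLaw, add_tsub_cancel_of_le (acceptedMeasure_le ha)]

theorem measurableSet_accept (a : ℝ) : MeasurableSet {p : ℝ × ℝ | p.2 * a + p.1 * p.1 ≤ a} :=
  measurableSet_le (by fun_prop) measurable_const

/-- The truncation in `ENNReal.ofReal` covers t² > a, where no uniform number passes the test. -/
theorem unifLaw_accept {a t : ℝ} (ha : 0 < a) :
    unifLaw {u | u * a + t * t ≤ a} = ENNReal.ofReal (1 - t ^ 2 / a) := by
  have h : {u : ℝ | u * a + t * t ≤ a} = Set.Iic (1 - t ^ 2 / a) := by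
    ext u
    rw [Set.mem_ofPred_eq, Set.mem_Iic, le_sub_iff_add_le, ← mul_le_mul_iff_left₀ ha]
    field_simp
  have h' : Set.Iic (1 - t ^ 2 / a) ∩ Set.Icc 0 1 = Set.Icc 0 (1 - t ^ 2 / a) := by
    have : 0 ≤ t ^ 2 / a := by positivity
    ext u
    simp only [Set.mem_inter_iff, Set.mem_Iic, Set.mem_Icc]
    constructor
    · tauto
    · intro h; exact ⟨h.2, h.1, by linarith [h.2]⟩
  rw [h, Measure.restrict_apply measurableSet_Iic, h']
  simp

/-- The event of a proposal being accepted with a value in `B`. -/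
theorem prod_accept_inter {a : ℝ} (ha : 0 < a) {B : Set ℝ} (hB : MeasurableSet B) :
    ((gaussianReal 0 1).prod unifLaw) {p | p.2 * a + p.1 * p.1 ≤ a ∧ p.1 ∈ B} =
      acceptedMeasure a B := by
  have hm : MeasurableSet {p : ℝ × ℝ | p.2 * a + p.1 * p.1 ≤ a ∧ p.1 ∈ B} :=
    (measurableSet_accept a).inter (measurable_fst hB)
  rw [Measure.prod_apply hm, acceptedMeasure, withDensity_apply _ hB,
    ← lintegral_indicator hB]
  refine lintegral_congr fun t => ?_
  by_cases ht : t ∈ B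
  · simp only [Set.preimage_ofPred_eq, ht, and_true, Set.indicator_of_mem]
    exact unifLaw_accept ha
  · simp [ht]

theorem tapeLaw_map_gauss_unif {i j : ℕ} (hij : i ≠ j) :
    tapeLaw.map (fun ω => ((ω i).2, (ω j).1)) = (gaussianReal 0 1).prod unifLaw := by
  have h : IndepFun (fun ω : RandomTape => ω i) (fun ω => ω j) tapeLaw :=
    (iIndepFun_infinitePi (X := fun _ => id) (fun _ => measurable_id)).indepFun hij
  have h' := h.comp measurable_snd measurable_fst
  have hi : tapeLaw.map (fun ω => ω i) = unifLaw.prod (gaussianReal 0 1) :=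
    Measure.infinitePi_map_eval _ i
  have hj : tapeLaw.map (fun ω => ω j) = unifLaw.prod (gaussianReal 0 1) :=
    Measure.infinitePi_map_eval _ j
  have := (indepFun_iff_map_prod_eq_prod_map_map
    (measurable_snd.comp (measurable_pi_apply i)).aemeasurable
    (measurable_fst.comp (measurable_pi_apply j)).aemeasurable).1 h'
  refine this.trans ?_
  rw [← Measure.map_map measurable_snd (by fun_prop), ← Measure.map_map measurable_fst (by fun_prop),
    hi, hj]
  simp

/-! ### Independence of the rounds -/

theorem lastAccepted_congr (a : ℝ) {ω ω' : RandomTape} (k : ℕ)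
    (h : ∀ i < 8 + 9 * k, ω i = ω' i) : lastAccepted a ω k = lastAccepted a ω' k := by
  induction k with
  | zero => rfl
  | succ k ih =>
    simp only [lastAccepted]
    rw [h (8 + 9 * k) (by omega), h (8 + 9 * k + 1) (by omega), ih fun i hi => h i (by omega)]

/-- The result of the first k rounds depends only on tape entries before 8 + 9k, a block disjoint
from the two entries read next. -/
theorem tapeLaw_map_round (a : ℝ) (k : ℕ) :
    tapeLaw.map (fun ω => (lastAccepted a ω k, ((ω (8 + 9 * k)).2, (ω (8 + 9 * k + 1)).1))) =
      (tapeLaw.map fun ω => lastAccepted a ω k).prod ((gaussianReal 0 1).prod unifLaw) := by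
  have hind : iIndepFun (fun i (ω : RandomTape) => ω i) tapeLaw :=
    iIndepFun_infinitePi (X := fun _ => id) (fun _ => measurable_id)
  have h := hind.indepFun_finset (Finset.range (8 + 9 * k)) {8 + 9 * k, 8 + 9 * k + 1}
    (by simp) (fun i => by fun_prop)
  -- Padding the finite block by zeros makes `lastAccepted` a function of that block alone.
  let e : (Finset.range (8 + 9 * k) → ℝ × ℝ) → RandomTape :=
    fun v i => if hi : i ∈ Finset.range (8 + 9 * k) then v ⟨i, hi⟩ else 0
  have he : Measurable e := by
    refine measurable_pi_lambda _ fun i => ?_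
    by_cases hi : i ∈ Finset.range (8 + 9 * k)
    · simp only [e, hi, dite_true]; fun_prop
    · simp only [e, hi, dite_false]; fun_prop
  let F : (({8 + 9 * k, 8 + 9 * k + 1} : Finset ℕ) → ℝ × ℝ) → ℝ × ℝ :=
    fun v => ((v ⟨8 + 9 * k, by simp⟩).2, (v ⟨8 + 9 * k + 1, by simp⟩).1)
  have hF : Measurable F := by fun_prop
  have h' := h.comp ((measurable_lastAccepted a k).comp he) hF
  have hr : ((fun ω => lastAccepted a ω k) ∘ e) ∘
      (fun (ω : RandomTape) (i : Finset.range (8 + 9 * k)) => ω i) =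
      fun ω => lastAccepted a ω k := by
    funext ω
    refine lastAccepted_congr a k fun i hi => ?_
    simp [e, hi]
  rw [hr, indepFun_iff_map_prod_eq_prod_map_map (measurable_lastAccepted a k).aemeasurable
    (hF.comp (by fun_prop)).aemeasurable] at h'
  rw [← tapeLaw_map_gauss_unif (i := 8 + 9 * k) (j := 8 + 9 * k + 1) (by simp)]
  exact h'

theorem tapeLaw_map_lastAccepted {a : ℝ} (ha : 0 < a) (k : ℕ) :
    tapeLaw.map (fun ω => lastAccepted a ω k) = samplerLaw a k := by
  induction k with
  | zero =>
    simp [lastAccepted, samplerLaw, Measure.map_const]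
  | succ k ih =>
    have := isProbabilityMeasure_samplerLaw ha k
    ext B hB
    set γ := (gaussianReal 0 1).prod unifLaw
    have hA : MeasurableSet {p : ℝ × ℝ | p.2 * a + p.1 * p.1 ≤ a ∧ p.1 ∈ B} :=
      (measurableSet_accept a).inter (measurable_fst hB)
    have hA' := measurableSet_accept a
    have hu : γ {p : ℝ × ℝ | p.2 * a + p.1 * p.1 ≤ a} = acceptedMeasure a Set.univ := by
      rw [← prod_accept_inter ha MeasurableSet.univ]; simp [γ]
    -- Conditioning on the newest round gives a disjoint union: it accepts a value in B, or it
    -- rejects and the older result lies in B. Keeping the last accepted proposal, not the first,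
    -- makes this match the recursion of `samplerLaw`.
    have hset : (fun ω => lastAccepted a ω (k + 1)) ⁻¹' B =
        (fun ω => (lastAccepted a ω k, ((ω (8 + 9 * k)).2, (ω (8 + 9 * k + 1)).1))) ⁻¹'
          (Set.univ ×ˢ {p : ℝ × ℝ | p.2 * a + p.1 * p.1 ≤ a ∧ p.1 ∈ B} ∪
            B ×ˢ {p : ℝ × ℝ | p.2 * a + p.1 * p.1 ≤ a}ᶜ) := by
      ext ω
      by_cases h : (ω (8 + 9 * k + 1)).1 * a + (ω (8 + 9 * k)).2 * (ω (8 + 9 * k)).2 ≤ a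
      · simp [lastAccepted, h]
      · simp [lastAccepted, h]
    have hmeas := ((MeasurableSet.univ (α := ℝ)).prod hA).union (hB.prod hA'.compl)
    have hmr := measurable_lastAccepted a k
    rw [Measure.map_apply (measurable_lastAccepted a _) hB, hset,
      ← Measure.map_apply (by fun_prop) hmeas, tapeLaw_map_round, ih,
      measure_union _ (hB.prod hA'.compl), Measure.prod_prod, Measure.prod_prod,
      prob_compl_eq_one_sub hA', hu, prod_accept_inter ha hB, samplerLaw]
    · simp [mul_comm]
    · rw [Set.disjoint_left]
      rintro ⟨x, p⟩ h1 h2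
      exact h2.2 h1.2.1

/-! ### Gaussian integrals -/

local notation "γ" => gaussianReal 0 1
local notation "φ" => gaussianPDFReal 0 1

theorem hasDerivAt_stdGaussianPDF (t : ℝ) : HasDerivAt φ (-t * φ t) t := by
  have h1 : HasDerivAt (fun t : ℝ => -(t - 0) ^ 2 / (2 * ((1 : NNReal) : ℝ))) (-t) t := by
    have := ((((hasDerivAt_id t).sub_const 0).pow 2).neg).div_const (2 * ((1 : NNReal) : ℝ))
    refine this.congr_deriv ?_
    simp only [id, sub_zero, NNReal.coe_one]
    ring
  have h2 := (h1.exp).const_mul ((√(2 * Real.pi * ((1 : NNReal) : ℝ)))⁻¹)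
  rw [gaussianPDFReal_def]
  refine h2.congr_deriv ?_
  ring

theorem integrable_gaussian_iff {f : ℝ → ℝ} :
    Integrable f γ ↔ Integrable fun t => φ t * f t := by
  rw [gaussianReal_of_var_ne_zero _ one_ne_zero,
    integrable_withDensity_iff_integrable_smul' (measurable_gaussianPDF _ _)
      (ae_of_all _ fun _ => gaussianPDF_lt_top)]
  simp

theorem integral_gaussian_eq (f : ℝ → ℝ) : ∫ t, f t ∂γ = ∫ t, φ t * f t := by
  simpa using integral_gaussianReal_eq_integral_smul (μ := 0) (v := 1) (f := f) one_ne_zero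

theorem integrable_sq_gaussian : Integrable (fun t : ℝ => t ^ 2) γ :=
  (memLp_id_gaussianReal 2).integrable_sq

theorem integral_sq_gaussian : ∫ t, t ^ 2 ∂γ = 1 := by
  have h := variance_id_gaussianReal (μ := 0) (v := 1)
  rw [variance_eq_integral measurable_id.aemeasurable] at h
  simpa using h

theorem integrable_id_gaussian : Integrable (fun t : ℝ => t) γ :=
  (memLp_id_gaussianReal 1).integrable le_rfl

/-- Multiplication by a two-sided exponential preserves integrability. -/
theorem integrable_gaussian_laplace_kernel {β : ℝ} (hβ : 0 < β) (z : ℝ) {f : ℝ → ℝ}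
    (hf : Integrable f γ) :
    Integrable fun t => Real.exp (-(β * |z - t|)) * (φ t * f t) := by
  refine (integrable_gaussian_iff.1 hf).bdd_mul (c := 1)
    (Continuous.aestronglyMeasurable (by fun_prop)) (ae_of_all _ fun t => ?_)
  rw [Real.norm_eq_abs, Real.abs_exp, Real.exp_le_one_iff, neg_nonpos]
  positivity

/-- The Laplace distribution is the Green's function of `1 - β⁻² D²`. -/
theorem integral_gaussian_laplace_kernel {β : ℝ} (hβ : 0 < β) (z : ℝ) :
    ∫ t, Real.exp (-(β * |z - t|)) * (φ t * (β ^ 2 + 1 - t ^ 2)) = 2 * β * φ z := by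
  have hint := integrable_gaussian_laplace_kernel hβ z (f := fun t => β ^ 2 + 1 - t ^ 2)
    ((integrable_const _).sub integrable_sq_gaussian)
  have hlin (c : ℝ) := integrable_gaussian_laplace_kernel hβ z (f := fun t => t + c)
    (integrable_id_gaussian.add (integrable_const c))
  rw [← setIntegral_univ, ← Set.Iic_union_Ioi (a := z),
    setIntegral_union (Set.Iic_disjoint_Ioi le_rfl) measurableSet_Ioi hint.integrableOn
      hint.integrableOn]
  have hL : ∫ t in Set.Iic z, Real.exp (-(β * |z - t|)) * (φ t * (β ^ 2 + 1 - t ^ 2)) =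
      φ z * (z + β) := by
    have hcongr (f : ℝ → ℝ) : Set.EqOn (fun t => Real.exp (-(β * |z - t|)) * (φ t * f t))
        (fun t => Real.exp (β * (t - z)) * (φ t * f t)) (Set.Iic z) := by
      intro t ht
      dsimp only
      rw [abs_of_nonneg (sub_nonneg.2 ht)]
      ring_nf
    -- Since φ' = -tφ, the integrand on each side of z has an explicit antiderivative. It vanishes
    -- at infinity because it and its derivative are both integrable, so only the value at z
    -- survives.
    have hd : ∀ t ∈ Set.Iic z, HasDerivAt (fun t => Real.exp (β * (t - z)) * (φ t * (t + β)))
        (Real.exp (β * (t - z)) * (φ t * (β ^ 2 + 1 - t ^ 2))) t := by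
      intro t _
      have := ((((hasDerivAt_id t).sub_const z).const_mul β).exp).mul
        ((hasDerivAt_stdGaussianPDF t).mul ((hasDerivAt_id t).add_const β))
      refine this.congr_deriv ?_
      simp only [id, Pi.mul_apply]
      ring
    have hi1 : IntegrableOn (fun t => Real.exp (β * (t - z)) * (φ t * (β ^ 2 + 1 - t ^ 2)))
        (Set.Iic z) := hint.integrableOn.congr_fun (hcongr _) measurableSet_Iic
    have hi2 : IntegrableOn (fun t => Real.exp (β * (t - z)) * (φ t * (t + β)))
        (Set.Iic z) := (hlin β).integrableOn.congr_fun (hcongr _) measurableSet_Iic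
    rw [setIntegral_congr_fun measurableSet_Iic (hcongr _),
      integral_Iic_of_hasDerivAt_of_tendsto' hd hi1
        (tendsto_zero_of_hasDerivAt_of_integrableOn_Iic hd hi1 hi2)]
    simp
  have hR : ∫ t in Set.Ioi z, Real.exp (-(β * |z - t|)) * (φ t * (β ^ 2 + 1 - t ^ 2)) =
      φ z * (β - z) := by
    have hcongr (f : ℝ → ℝ) : Set.EqOn (fun t => Real.exp (-(β * |z - t|)) * (φ t * f t))
        (fun t => Real.exp (-β * (t - z)) * (φ t * f t)) (Set.Ioi z) := by
      intro t ht
      dsimp only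
      rw [abs_of_nonpos (sub_nonpos.2 (le_of_lt ht))]
      ring_nf
    have hd (t : ℝ) : HasDerivAt (fun t => Real.exp (-β * (t - z)) * (φ t * (t + -β)))
        (Real.exp (-β * (t - z)) * (φ t * (β ^ 2 + 1 - t ^ 2))) t := by
      have := ((((hasDerivAt_id t).sub_const z).const_mul (-β)).exp).mul
        ((hasDerivAt_stdGaussianPDF t).mul ((hasDerivAt_id t).add_const (-β)))
      refine this.congr_deriv ?_
      simp only [id, Pi.mul_apply]
      ring
    have hi1 : IntegrableOn (fun t => Real.exp (-β * (t - z)) * (φ t * (β ^ 2 + 1 - t ^ 2)))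
        (Set.Ioi z) := hint.integrableOn.congr_fun (hcongr _) measurableSet_Ioi
    have hi2 : IntegrableOn (fun t => Real.exp (-β * (t - z)) * (φ t * (t + -β)))
        (Set.Ioi z) := (hlin (-β)).integrableOn.congr_fun (hcongr _) measurableSet_Ioi
    rw [setIntegral_congr_fun measurableSet_Ioi (hcongr _),
      integral_Ioi_of_hasDerivAt_of_tendsto' (fun t _ => hd t) hi1
        (tendsto_zero_of_hasDerivAt_of_integrableOn_Ioi (fun t _ => hd t) hi1 hi2)]
    simp only [sub_self, mul_zero, Real.exp_zero]
    ring
  rw [hL, hR]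
  ring

/-! ### Moments of the two-sided exponential -/

theorem integral_exp_neg_mul_abs {r : ℝ} (hr : 0 < r) :
    ∫ x, Real.exp (-(r * |x|)) = 2 / r := by
  rw [integral_comp_abs (f := fun x => Real.exp (-(r * x)))]
  have := integral_exp_mul_Ioi (neg_neg_iff_pos.2 hr) 0
  simp only [neg_mul, mul_zero, Real.exp_zero] at this
  rw [this]
  field_simp

theorem integrable_exp_neg_mul_abs {r : ℝ} (hr : 0 < r) :
    Integrable fun x => Real.exp (-(r * |x|)) :=
  -- The Bochner integral of a non-integrable function is 0, so a nonzero value proves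
  -- integrability.
  .of_integral_ne_zero (by rw [integral_exp_neg_mul_abs hr]; positivity)

theorem integral_sq_mul_exp_neg_mul_abs {r : ℝ} (hr : 0 < r) :
    ∫ x, x ^ 2 * Real.exp (-(r * |x|)) = 4 / r ^ 3 := by
  have h := integral_comp_abs (f := fun x => x ^ 2 * Real.exp (-(r * x)))
  simp only [sq_abs] at h
  rw [h]
  have := Real.integral_rpow_mul_exp_neg_mul_Ioi (a := 3) (by norm_num) hr
  have hg : Real.Gamma 3 = 2 := by
    rw [show (3 : ℝ) = (2 : ℕ) + 1 by norm_num, Real.Gamma_nat_eq_factorial]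
    norm_num [Nat.factorial]
  have h2 : (3 : ℝ) - 1 = (2 : ℕ) := by norm_num
  rw [hg, h2, show (3 : ℝ) = (3 : ℕ) by norm_num] at this
  simp only [Real.rpow_natCast] at this
  rw [this]
  field_simp
  norm_num

theorem integrable_sq_mul_exp_neg_mul_abs {r : ℝ} (hr : 0 < r) :
    Integrable fun x => x ^ 2 * Real.exp (-(r * |x|)) :=
  .of_integral_ne_zero (by rw [integral_sq_mul_exp_neg_mul_abs hr]; positivity)

/-- Convolution with the Laplace distribution turns the signed density
`(β² + 1 - t²) φ(t)` into `β² φ`. -/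
theorem integral_laplace_smoothing {β : ℝ} (hβ : 0 < β) {C : Set ℝ} (hC : MeasurableSet C) :
    ∫ t, (∫ z in C, β / 2 * Real.exp (-(β * |z - t|))) * (β ^ 2 + 1 - t ^ 2) ∂γ =
      β ^ 2 * (γ).real C := by
  have h1 := (integrable_gaussian_iff (f := fun t => β ^ 2 + 1 - t ^ 2)).1
    ((integrable_const (β ^ 2 + 1)).sub integrable_sq_gaussian)
  have h2 := (integrable_exp_neg_mul_abs hβ).const_mul (β / 2)
  -- Fubini is justified by viewing the double integrand as that of a convolution of two integrable
  -- functions.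
  have h3 := (h1.convolution_integrand (ContinuousLinearMap.mul ℝ ℝ) h2).integrableOn
    (s := C ×ˢ Set.univ)
  rw [IntegrableOn, ← Measure.prod_restrict, Measure.restrict_univ] at h3
  simp only [ContinuousLinearMap.mul_apply'] at h3
  have h4 := integral_integral_swap
    (f := fun z t => φ t * (β ^ 2 + 1 - t ^ 2) * (β / 2 * Real.exp (-(β * |z - t|)))) h3
  have h5 (t : ℝ) : φ t * ((∫ z in C, β / 2 * Real.exp (-(β * |z - t|))) * (β ^ 2 + 1 - t ^ 2)) =
      ∫ z in C, φ t * (β ^ 2 + 1 - t ^ 2) * (β / 2 * Real.exp (-(β * |z - t|))) := by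
    simp only [integral_const_mul]; ring
  rw [integral_gaussian_eq]
  simp_rw [h5]
  refine h4.symm.trans ?_
  have h6 (z : ℝ) : ∫ t, φ t * (β ^ 2 + 1 - t ^ 2) * (β / 2 * Real.exp (-(β * |z - t|))) =
      β ^ 2 * φ z := by
    rw [show β ^ 2 * φ z = β / 2 * (2 * β * φ z) by ring, ← integral_gaussian_laplace_kernel hβ z,
      ← integral_const_mul]
    congr 1
    funext t
    ring
  refine (integral_congr_ae (ae_of_all _ h6)).trans ?_
  rw [integral_const_mul, Measure.real, gaussianReal_apply_eq_integral _ one_ne_zero,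
    ENNReal.toReal_ofReal (setIntegral_nonneg hC fun t _ => gaussianPDFReal_nonneg _ _ _)]

/-- The tilt L / (2L + 1) stays below 1/2, leaving an unnormalised Gaussian of variance 2L + 1. It
is the moment needed for a Chernoff bound at level t² = 2L + 1. -/
theorem integral_exp_sq_gaussian {L : ℝ} (hL : 0 < L) :
    Integrable (fun t : ℝ => Real.exp (L * (t ^ 2 / (2 * L + 1)))) γ ∧
      ∫ t, Real.exp (L * (t ^ 2 / (2 * L + 1))) ∂γ = √(2 * L + 1) := by
  have h (t : ℝ) : φ t * Real.exp (L * (t ^ 2 / (2 * L + 1))) =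
      (√(2 * Real.pi))⁻¹ * Real.exp (-(1 / (2 * (2 * L + 1))) * t ^ 2) := by
    rw [gaussianPDFReal_def]
    simp only [NNReal.coe_one, mul_one, sub_zero]
    rw [mul_assoc, ← Real.exp_add]
    congr 2
    field_simp
    ring
  constructor
  · rw [integrable_gaussian_iff]
    simp_rw [h]
    exact (integrable_exp_neg_mul_sq (by positivity)).const_mul _
  · rw [integral_gaussian_eq]
    simp_rw [h]
    rw [integral_const_mul, integral_gaussian, ← Real.sqrt_inv, ← Real.sqrt_mul (by positivity)]
    congr 1
    field_simp

/-- The negative part of the signed density. -/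
theorem integral_negPart_le {L : ℝ} (hL : 2 ≤ L) :
    ∫ t, max (t ^ 2 / (2 * L + 1) - 1) 0 ∂γ ≤ 2 * Real.exp (-L) := by
  obtain ⟨hi, he⟩ := integral_exp_sq_gaussian (L := L) (by linarith)
  calc ∫ t, max (t ^ 2 / (2 * L + 1) - 1) 0 ∂γ
      ≤ ∫ t, Real.exp (-L) / L * Real.exp (L * (t ^ 2 / (2 * L + 1))) ∂γ := by
        refine integral_mono_of_nonneg (ae_of_all _ fun t => le_max_right _ _) (hi.const_mul _)
          (ae_of_all _ fun t => ?_)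
        refine max_le ?_ (by positivity)
        dsimp only
        rw [div_mul_eq_mul_div, ← Real.exp_add, le_div_iff₀ (by linarith)]
        -- With y = L(t²/a - 1), the bound y ≤ exp y gives t²/a - 1 ≤ exp(y)/L.
        have := Real.add_one_le_exp (-L + L * (t ^ 2 / (2 * L + 1)))
        linarith
    _ = √(2 * L + 1) / L * Real.exp (-L) := by
        rw [integral_const_mul, he]; ring
    _ ≤ 2 * Real.exp (-L) := by
        refine mul_le_mul_of_nonneg_right ?_ (Real.exp_pos _).le
        rw [div_le_iff₀ (by linarith)]
        exact Real.sqrt_le_iff.2 ⟨by linarith, by nlinarith⟩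

/-! ### The law of the sampler compared with a Gaussian -/

theorem isFiniteMeasure_acceptedMeasure {a : ℝ} (ha : 0 < a) :
    IsFiniteMeasure (acceptedMeasure a) :=
  ⟨(acceptedMeasure_le ha).trans_lt ENNReal.one_lt_top⟩

theorem integral_acceptedMeasure (a : ℝ) (h : ℝ → ℝ) :
    ∫ t, h t ∂(acceptedMeasure a) = ∫ t, max (1 - t ^ 2 / a) 0 * h t ∂γ := by
  rw [acceptedMeasure, integral_withDensity_eq_integral_toReal_smul (by fun_prop) (by simp)]
  simp [ENNReal.toReal_ofReal']

theorem integrable_one_sub_sq_div (a : ℝ) : Integrable (fun t : ℝ => 1 - t ^ 2 / a) γ :=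
  (integrable_const 1).sub (integrable_sq_gaussian.div_const a)

theorem integral_one_sub_sq_div (a : ℝ) : ∫ t, (1 - t ^ 2 / a) ∂γ = 1 - 1 / a := by
  rw [integral_sub (integrable_const 1) (integrable_sq_gaussian.div_const a), integral_div,
    integral_sq_gaussian]
  simp

theorem integrable_negPart (a : ℝ) : Integrable (fun t : ℝ => max (t ^ 2 / a - 1) 0) γ :=
  ((integrable_sq_gaussian.div_const a).sub (integrable_const 1)).pos_part

theorem integrable_of_mem_Icc {μ : Measure ℝ} [IsFiniteMeasure μ] {q : ℝ → ℝ} (hq : Measurable q)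
    (h0 : ∀ t, 0 ≤ q t) (h1 : ∀ t, q t ≤ 1) : Integrable q μ :=
  .of_bound hq.aestronglyMeasurable 1
    (ae_of_all _ fun t => by rw [Real.norm_of_nonneg (h0 t)]; exact h1 t)

theorem integral_acceptedMeasure_eq (a : ℝ) {q : ℝ → ℝ} (hq : Measurable q)
    (h0 : ∀ t, 0 ≤ q t) (h1 : ∀ t, q t ≤ 1) :
    ∫ t, q t ∂(acceptedMeasure a) =
      ∫ t, q t * (1 - t ^ 2 / a) ∂γ + ∫ t, q t * max (t ^ 2 / a - 1) 0 ∂γ := by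
  have hb : ∀ᵐ t ∂γ, ‖q t‖ ≤ 1 := ae_of_all _ fun t => by
    rw [Real.norm_of_nonneg (h0 t)]; exact h1 t
  rw [integral_acceptedMeasure, ← integral_add
    ((integrable_one_sub_sq_div a).bdd_mul hq.aestronglyMeasurable hb)
    ((integrable_negPart a).bdd_mul hq.aestronglyMeasurable hb)]
  congr 1
  funext t
  rcases le_total (t ^ 2 / a) 1 with h | h
  · rw [max_eq_left (by linarith), max_eq_right (by linarith)]; ring
  · rw [max_eq_right (by linarith), max_eq_left (by linarith)]; ring

/-- Restoring the negative part adds m = ∫ q · max(t²/a - 1, 0) to the integral of q and M = ∫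
max(t²/a - 1, 0) to the total mass. The (1 - 1/a) G terms cancel, leaving m - M G with both m and M
G in [0, M]. -/
theorem abs_integral_acceptedMeasure_sub_le (a : ℝ) {q : ℝ → ℝ} (hq : Measurable q)
    (h0 : ∀ t, 0 ≤ q t) (h1 : ∀ t, q t ≤ 1) {G : ℝ} (hG0 : 0 ≤ G) (hG1 : G ≤ 1)
    (hG : ∫ t, q t * (1 - t ^ 2 / a) ∂γ = (1 - 1 / a) * G) :
    |∫ t, q t ∂(acceptedMeasure a) - (acceptedMeasure a).real Set.univ * G| ≤
      ∫ t, max (t ^ 2 / a - 1) 0 ∂γ := by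
  have hZ := integral_acceptedMeasure_eq a (q := fun _ => 1) measurable_const (by simp) (by simp)
  simp only [one_mul, integral_one_sub_sq_div, integral_const, smul_eq_mul, mul_one] at hZ
  rw [integral_acceptedMeasure_eq a hq h0 h1, hG, hZ]
  set M := ∫ t, max (t ^ 2 / a - 1) 0 ∂γ
  have hb : ∀ᵐ t ∂γ, ‖q t‖ ≤ 1 := ae_of_all _ fun t => by
    rw [Real.norm_of_nonneg (h0 t)]; exact h1 t
  have hm0 : 0 ≤ ∫ t, q t * max (t ^ 2 / a - 1) 0 ∂γ :=
    integral_nonneg fun t => mul_nonneg (h0 t) (le_max_right _ _)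
  have hm1 : ∫ t, q t * max (t ^ 2 / a - 1) 0 ∂γ ≤ M :=
    integral_mono ((integrable_negPart a).bdd_mul hq.aestronglyMeasurable hb)
      (integrable_negPart a) fun t => mul_le_of_le_one_left (le_max_right _ _) (h1 t)
  have hM : 0 ≤ M := hm0.trans hm1
  rw [abs_le]
  constructor <;> nlinarith [mul_nonneg hM hG0, mul_le_of_le_one_right hM hG1]

theorem one_sub_le_acceptedMeasure (a : ℝ) :
    1 - 1 / a ≤ (acceptedMeasure a).real Set.univ := by
  have hZ := integral_acceptedMeasure_eq a (q := fun _ => 1) measurable_const (by simp) (by simp)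
  simp only [one_mul, integral_one_sub_sq_div, integral_const, smul_eq_mul, mul_one] at hZ
  rw [hZ]
  exact le_add_of_nonneg_right (integral_nonneg fun t => le_max_right _ _)

/-- The errors satisfy e₀ ≤ 1 and eₖ₊₁ ≤ M + eₖ/5, where M is the negative mass; the fixed point of
this recursion is 5M/4. -/
theorem abs_integral_samplerLaw_sub_le {a : ℝ} (ha : 5 ≤ a) {q : ℝ → ℝ} (hq : Measurable q)
    (h0 : ∀ t, 0 ≤ q t) (h1 : ∀ t, q t ≤ 1) {G : ℝ} (hG0 : 0 ≤ G) (hG1 : G ≤ 1)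
    (hG : ∫ t, q t * (1 - t ^ 2 / a) ∂γ = (1 - 1 / a) * G) (k : ℕ) :
    |∫ t, q t ∂(samplerLaw a k) - G| ≤
      5 / 4 * ∫ t, max (t ^ 2 / a - 1) 0 ∂γ + (1 / 5) ^ k := by
  have ha0 : 0 < a := by linarith
  have := isFiniteMeasure_acceptedMeasure ha0
  have hM : 0 ≤ ∫ t, max (t ^ 2 / a - 1) 0 ∂γ := integral_nonneg fun t => le_max_right _ _
  have hA := abs_integral_acceptedMeasure_sub_le a hq h0 h1 hG0 hG1 hG
  have hZ := one_sub_le_acceptedMeasure a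
  have hZ1 : (acceptedMeasure a).real Set.univ ≤ 1 :=
    ENNReal.toReal_le_of_le_ofReal zero_le_one (by simpa using acceptedMeasure_le ha0)
  set M := ∫ t, max (t ^ 2 / a - 1) 0 ∂γ
  induction k with
  | zero =>
    simp only [samplerLaw, integral_dirac, pow_zero]
    rw [abs_le]
    constructor <;> linarith [h0 0, h1 0]
  | succ k ih =>
    have := isProbabilityMeasure_samplerLaw ha0 k
    have hr : (1 - acceptedMeasure a Set.univ).toReal = 1 - (acceptedMeasure a).real Set.univ := by
      rw [ENNReal.toReal_sub_of_le (acceptedMeasure_le ha0) (by simp)]; rfl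
    rw [samplerLaw, integral_add_measure (integrable_of_mem_Icc hq h0 h1)
      ((integrable_of_mem_Icc hq h0 h1).smul_measure (ENNReal.sub_ne_top (by simp))),
      integral_smul_measure, hr, smul_eq_mul]
    set Z := (acceptedMeasure a).real Set.univ
    have ha5 : 1 / a ≤ 1 / 5 := one_div_le_one_div_of_le (by norm_num) ha
    have hdec : ∫ t, q t ∂(acceptedMeasure a) + (1 - Z) * ∫ t, q t ∂(samplerLaw a k) - G =
        (∫ t, q t ∂(acceptedMeasure a) - Z * G) + (1 - Z) * (∫ t, q t ∂(samplerLaw a k) - G) := by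
      ring
    rw [hdec]
    refine (abs_add_le _ _).trans ?_
    rw [abs_mul, abs_of_nonneg (sub_nonneg.2 hZ1), pow_succ]
    have := mul_le_mul (show 1 - Z ≤ 1 / 5 by linarith) ih (abs_nonneg _) (by norm_num)
    linarith

/-- Accepted proposals have second moment at most one. -/
theorem lintegral_sq_acceptedMeasure_le {a : ℝ} (ha : 0 < a) :
    ∫⁻ t, ENNReal.ofReal (t ^ 2) ∂(acceptedMeasure a) ≤ acceptedMeasure a Set.univ := by
  have hw : ∀ t : ℝ, ENNReal.ofReal (1 - t ^ 2 / a) = ENNReal.ofReal (max (1 - t ^ 2 / a) 0) :=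
    fun t => by rw [ENNReal.ofReal_max, ENNReal.ofReal_zero, max_eq_left zero_le]
  have hmeas : Measurable fun t : ℝ => max (1 - t ^ 2 / a) 0 := by fun_prop
  have hwb : ∀ᵐ t ∂γ, ‖max (1 - t ^ 2 / a) 0‖ ≤ 1 := ae_of_all _ fun t => by
    rw [Real.norm_of_nonneg (le_max_right _ _)]
    have : 0 ≤ t ^ 2 / a := by positivity
    exact max_le (by linarith) zero_le_one
  have hi1 : Integrable (fun t : ℝ => max (1 - t ^ 2 / a) 0) γ :=
    .of_bound hmeas.aestronglyMeasurable 1 hwb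
  have hi2 : Integrable (fun t : ℝ => max (1 - t ^ 2 / a) 0 * t ^ 2) γ :=
    integrable_sq_gaussian.bdd_mul hmeas.aestronglyMeasurable hwb
  have key : ∫ t, max (1 - t ^ 2 / a) 0 * t ^ 2 ∂γ ≤ ∫ t, max (1 - t ^ 2 / a) 0 ∂γ := by
    -- Chebyshev's association inequality: w(t) = max(1 - t²/a, 0) decreases in t², so w(t)(t² - 1)
    -- ≤ w(1)(t² - 1), and the right side has Gaussian mean 0.
    have hz : ∫ t, max (1 - 1 / a) 0 * (t ^ 2 - 1) ∂γ = 0 := by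
      rw [integral_const_mul, integral_sub integrable_sq_gaussian (integrable_const 1),
        integral_sq_gaussian]
      simp
    rw [← sub_nonpos, ← integral_sub hi2 hi1]
    refine le_trans ?_ hz.le
    refine integral_mono (hi2.sub hi1)
      ((integrable_sq_gaussian.sub (integrable_const 1)).const_mul _) fun t => ?_
    have hmono : ∀ x y : ℝ, x ≤ y → max (1 - y / a) 0 ≤ max (1 - x / a) 0 := fun x y hxy =>
      max_le_max_right _ (sub_le_sub_left (div_le_div_of_nonneg_right hxy ha.le) 1)
    dsimp only
    rcases le_total (t ^ 2) 1 with h | h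
    · nlinarith [hmono _ _ h]
    · nlinarith [hmono _ _ h]
  rw [acceptedMeasure, lintegral_withDensity_eq_lintegral_mul _ (by fun_prop) (by fun_prop),
    withDensity_apply _ MeasurableSet.univ, Measure.restrict_univ]
  simp only [Pi.mul_apply, hw]
  simp_rw [← ENNReal.ofReal_mul (le_max_right _ (0 : ℝ))]
  rw [← ofReal_integral_eq_lintegral_ofReal hi2
      (ae_of_all _ fun t => mul_nonneg (le_max_right _ _) (sq_nonneg t)),
    ← ofReal_integral_eq_lintegral_ofReal hi1 (ae_of_all _ fun t => le_max_right _ _)]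
  exact ENNReal.ofReal_le_ofReal key

theorem lintegral_sq_samplerLaw_le {a : ℝ} (ha : 0 < a) (k : ℕ) :
    ∫⁻ t, ENNReal.ofReal (t ^ 2) ∂(samplerLaw a k) ≤ 1 := by
  induction k with
  | zero => simp [samplerLaw]
  | succ k ih =>
    rw [samplerLaw, lintegral_add_measure, lintegral_smul_measure, smul_eq_mul]
    calc _ ≤ acceptedMeasure a Set.univ + (1 - acceptedMeasure a Set.univ) * 1 := by
          gcongr
          exact lintegral_sq_acceptedMeasure_le ha
      _ = 1 := by rw [mul_one, add_tsub_cancel_of_le (acceptedMeasure_le ha)]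

/-! ### The Laplace distribution -/

theorem laplaceMeasure_zero (b : ℝ) : laplaceMeasure 0 b =
    volume.withDensity fun x => ENNReal.ofReal (1 / (2 * b) * Real.exp (-(b⁻¹ * |x|))) := by
  unfold laplaceMeasure
  congr 1
  funext x
  rw [sub_zero, neg_div, div_eq_inv_mul |x|]

theorem integrable_laplace_density {b : ℝ} (hb : 0 < b) :
    Integrable fun x : ℝ => 1 / (2 * b) * Real.exp (-(b⁻¹ * |x|)) :=
  (integrable_exp_neg_mul_abs (inv_pos.2 hb)).const_mul _

theorem isProbabilityMeasure_laplaceMeasure {b : ℝ} (hb : 0 < b) :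
    IsProbabilityMeasure (laplaceMeasure 0 b) := by
  constructor
  rw [laplaceMeasure_zero, withDensity_apply _ MeasurableSet.univ, Measure.restrict_univ,
    ← ofReal_integral_eq_lintegral_ofReal (integrable_laplace_density hb)
      (ae_of_all _ fun x => by positivity), integral_const_mul,
    integral_exp_neg_mul_abs (inv_pos.2 hb)]
  simp
  field_simp

theorem laplaceMeasure_real {b : ℝ} (hb : 0 < b) {S : Set ℝ} (hS : MeasurableSet S) :
    (laplaceMeasure 0 b).real S = ∫ x in S, 1 / (2 * b) * Real.exp (-(b⁻¹ * |x|)) := by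
  rw [Measure.real, laplaceMeasure_zero, withDensity_apply _ hS,
    ← ofReal_integral_eq_lintegral_ofReal (integrable_laplace_density hb).integrableOn
      (ae_of_all _ fun x => by positivity),
    ENNReal.toReal_ofReal (integral_nonneg fun x => by positivity)]

theorem laplaceMeasure_real_scaled {b β : ℝ} (hb : 0 < b) (hβ : 0 < β) (θ t : ℝ) {B : Set ℝ}
    (hB : MeasurableSet B) :
    (laplaceMeasure 0 b).real {ξ | θ + (ξ + b * β * t) ∈ B} =
      ∫ z in {z | θ + b * β * z ∈ B}, β / 2 * Real.exp (-(β * |z - t|)) := by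
  have hS : MeasurableSet {ξ : ℝ | θ + (ξ + b * β * t) ∈ B} :=
    (show Measurable fun ξ : ℝ => θ + (ξ + b * β * t) by fun_prop) hB
  have hC : MeasurableSet {z : ℝ | θ + b * β * z ∈ B} :=
    (show Measurable fun z : ℝ => θ + b * β * z by fun_prop) hB
  rw [laplaceMeasure_real hb hS, ← integral_indicator hS, ← integral_indicator hC]
  set F := Set.indicator {ξ : ℝ | θ + (ξ + b * β * t) ∈ B}
    fun x => 1 / (2 * b) * Real.exp (-(b⁻¹ * |x|)) with hF
  have hbβ : 0 < b * β := mul_pos hb hβ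
  -- Substitution ξ = bβ(z - t), passing to units of bβ.
  have h1 : ∫ x, F x = b * β * ∫ z, F (b * β * (z - t)) := by
    rw [integral_sub_right_eq_self (fun z => F (b * β * z)) t, Measure.integral_comp_mul_left,
      abs_of_pos (inv_pos.2 hbβ), smul_eq_mul, mul_inv_cancel_left₀ hbβ.ne']
  rw [h1, ← integral_const_mul]
  congr 1
  funext z
  have hmem : b * β * (z - t) ∈ {ξ : ℝ | θ + (ξ + b * β * t) ∈ B} ↔
      z ∈ {z : ℝ | θ + b * β * z ∈ B} := by
    simp only [Set.mem_ofPred_eq]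
    rw [show b * β * (z - t) + b * β * t = b * β * z by ring]
  by_cases hz : z ∈ {z : ℝ | θ + b * β * z ∈ B}
  · rw [hF, Set.indicator_of_mem (hmem.2 hz), Set.indicator_of_mem hz, abs_mul, abs_of_pos hbβ]
    field_simp
  · rw [hF, Set.indicator_of_notMem (mt hmem.1 hz), Set.indicator_of_notMem hz, mul_zero]

/-- The cross term vanishes by symmetry; c will be the scaled output of the sampler. -/
theorem lintegral_sq_add_laplaceMeasure {b : ℝ} (hb : 0 < b) (c : ℝ) :
    ∫⁻ ξ, ENNReal.ofReal ((ξ + c) ^ 2) ∂(laplaceMeasure 0 b) =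
      ENNReal.ofReal (2 * b ^ 2 + c ^ 2) := by
  have hr := inv_pos.2 hb
  have i0 := integrable_exp_neg_mul_abs hr
  have i2 := integrable_sq_mul_exp_neg_mul_abs hr
  have i1 : Integrable fun x => x * Real.exp (-(b⁻¹ * |x|)) := by
    refine (i0.add i2).mono' (Continuous.aestronglyMeasurable (by fun_prop)) (ae_of_all _ fun x => ?_)
    rw [norm_mul, Real.norm_eq_abs, Real.norm_eq_abs, Real.abs_exp, Pi.add_apply, ← one_add_mul]
    refine mul_le_mul_of_nonneg_right ?_ (Real.exp_pos _).le
    nlinarith [sq_abs x, sq_nonneg (|x| - 1), abs_nonneg x]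
  have e1 : ∫ x, x * Real.exp (-(b⁻¹ * |x|)) = 0 := by
    have := integral_neg_eq_self (fun x : ℝ => x * Real.exp (-(b⁻¹ * |x|))) volume
    simp only [abs_neg, neg_mul, integral_neg] at this
    linarith
  have hexp (x : ℝ) : 1 / (2 * b) * Real.exp (-(b⁻¹ * |x|)) * (x + c) ^ 2 =
      1 / (2 * b) * (x ^ 2 * Real.exp (-(b⁻¹ * |x|)) + (2 * c * (x * Real.exp (-(b⁻¹ * |x|))) +
        c ^ 2 * Real.exp (-(b⁻¹ * |x|)))) := by ring
  have hint : Integrable fun x => 1 / (2 * b) * Real.exp (-(b⁻¹ * |x|)) * (x + c) ^ 2 := by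
    simp_rw [hexp]
    exact (i2.add ((i1.const_mul _).add (i0.const_mul _))).const_mul _
  rw [laplaceMeasure_zero, lintegral_withDensity_eq_lintegral_mul _ (by fun_prop) (by fun_prop)]
  simp only [Pi.mul_apply]
  have hmul (x : ℝ) : ENNReal.ofReal (1 / (2 * b) * Real.exp (-(b⁻¹ * |x|))) *
      ENNReal.ofReal ((x + c) ^ 2) =
      ENNReal.ofReal (1 / (2 * b) * Real.exp (-(b⁻¹ * |x|)) * (x + c) ^ 2) :=
    (ENNReal.ofReal_mul (by positivity)).symm
  simp_rw [hmul]
  rw [← ofReal_integral_eq_lintegral_ofReal hint (ae_of_all _ fun x => by positivity)]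
  simp_rw [hexp]
  have hs := (i1.const_mul (2 * c)).add (i0.const_mul (c ^ 2))
  simp only [Pi.add_def] at hs
  rw [integral_const_mul, integral_add i2 hs, integral_add (i1.const_mul _) (i0.const_mul _), integral_const_mul, integral_const_mul, e1,
    integral_exp_neg_mul_abs hr, integral_sq_mul_exp_neg_mul_abs hr]
  congr 1
  field_simp
  ring

theorem laplaceMeasure_map_add (θ b : ℝ) :
    (laplaceMeasure 0 b).map (fun z => θ + z) = laplaceMeasure θ b := by
  ext B hB
  have hm : Measurable fun z : ℝ => θ + z := by fun_prop
  rw [Measure.map_apply hm hB]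
  simp only [laplaceMeasure]
  rw [withDensity_apply _ (hm hB), withDensity_apply _ hB,
    ← lintegral_indicator (hm hB), ← lintegral_indicator hB, ← lintegral_add_left_eq_self (B.indicator _) θ]
  refine lintegral_congr fun x => ?_
  by_cases hx : θ + x ∈ B
  · rw [Set.indicator_of_mem (show x ∈ (fun z => θ + z) ⁻¹' B from hx), Set.indicator_of_mem hx]
    simp
  · rw [Set.indicator_of_notMem (show x ∉ (fun z => θ + z) ⁻¹' B from hx),
      Set.indicator_of_notMem hx]

/-- The triangle inequality bounds the ratio of the densities pointwise. Stated as domination of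
measures, the bound passes through any kernel. -/
theorem laplaceMeasure_le {b ε : ℝ} (hb : 0 < b) {θ θ' : ℝ} (h : |θ - θ'| ≤ ε) :
    laplaceMeasure θ b ≤ ENNReal.ofReal (Real.exp (ε / b)) • laplaceMeasure θ' b := by
  unfold laplaceMeasure
  rw [← withDensity_smul _ (by fun_prop)]
  refine withDensity_mono (ae_of_all _ fun x => ?_)
  rw [Pi.smul_apply, smul_eq_mul, ← ENNReal.ofReal_mul (Real.exp_pos _).le]
  refine ENNReal.ofReal_le_ofReal ?_
  rw [mul_left_comm, ← Real.exp_add, ← add_div]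
  have : |x - θ'| ≤ |x - θ| + |θ - θ'| := abs_sub_le x θ θ'
  gcongr
  linarith

/-! ### The post-processing kernel -/

/-- The law of `x + σ r` with `r` drawn from the law of the rejection sampler. -/
noncomputable def samplerKernel (a σ : ℝ) (k : ℕ) : Kernel ℝ ℝ :=
  (Kernel.id ×ₖ Kernel.const ℝ (samplerLaw a k)).map fun p => p.1 + σ * p.2

theorem samplerKernel_apply {a : ℝ} (ha : 0 < a) (σ : ℝ) (k : ℕ) (x : ℝ) :
    samplerKernel a σ k x = (samplerLaw a k).map fun r => x + σ * r := by
  have := isProbabilityMeasure_samplerLaw ha k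
  have hm : Measurable fun p : ℝ × ℝ => p.1 + σ * p.2 := by fun_prop
  rw [samplerKernel, Kernel.map_apply _ hm, Kernel.prod_apply, Kernel.id_apply, Kernel.const_apply,
    Measure.dirac_prod, Measure.map_map hm (by fun_prop)]
  rfl

theorem isMarkovKernel_samplerKernel {a : ℝ} (ha : 0 < a) (σ : ℝ) (k : ℕ) :
    IsMarkovKernel (samplerKernel a σ k) := by
  have := isProbabilityMeasure_samplerLaw ha k
  exact Kernel.IsMarkovKernel.map _ (by fun_prop)

theorem laplace_followedBy_samplerKernel {𝒳 : Type*} {n : ℕ} (f : (Fin n → 𝒳) → ℝ) {a b : ℝ}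
    (ha : 0 < a) (hb : 0 < b) (σ : ℝ) (k : ℕ) (X : Fin n → 𝒳) :
    (laplaceMechanism f b).followedBy (samplerKernel a σ k) X =
      ((laplaceMeasure 0 b).prod (samplerLaw a k)).map fun p => f X + (p.1 + σ * p.2) := by
  have := isProbabilityMeasure_samplerLaw ha k
  have := isProbabilityMeasure_laplaceMeasure hb
  ext B hB
  have hm : Measurable fun p : ℝ × ℝ => f X + (p.1 + σ * p.2) := by fun_prop
  rw [Mechanism.followedBy, Measure.bind_apply hB (samplerKernel a σ k).aemeasurable,
    laplaceMechanism, lintegral_map ((samplerKernel a σ k).measurable_coe hB) (by fun_prop),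
    Measure.map_apply hm hB, Measure.prod_apply (hm hB)]
  refine lintegral_congr fun ξ => ?_
  rw [samplerKernel_apply ha, Measure.map_apply (by fun_prop) hB]
  congr 1
  ext r
  simp [add_assoc]

/-- The test function is q(t), the probability that Laplace noise carries the sampler value t into
B. Integrated against the signed density it gives exactly the Gaussian probability of B, up to the
factor 1 - 1/a. -/
theorem tvDist_sampler_le {𝒳 : Type*} {n : ℕ} (f : (Fin n → 𝒳) → ℝ) {b L : ℝ} (hb : 0 < b)
    (hL : 2 ≤ L) (k : ℕ) (X : Fin n → 𝒳) :
    tvDist ((laplaceMechanism f b).followedBy (samplerKernel (2 * L + 1) (b * √(2 * L)) k) X)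
      (gaussianMechanism f (2 * b ^ 2 * L) X) ≤ 5 / 2 * Real.exp (-L) + (1 / 5) ^ k := by
  have ha : 0 < 2 * L + 1 := by linarith
  have := isProbabilityMeasure_samplerLaw ha k
  have := isProbabilityMeasure_laplaceMeasure hb
  have hβ : 0 < √(2 * L) := Real.sqrt_pos.2 (by linarith)
  have hβ2 : √(2 * L) ^ 2 = 2 * L := Real.sq_sqrt (by linarith)
  set β := √(2 * L)
  have : Nonempty {B : Set ℝ // MeasurableSet B} := ⟨⟨∅, MeasurableSet.empty⟩⟩
  refine ciSup_le fun ⟨B, hB⟩ => ?_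
  dsimp only
  have hC : MeasurableSet {z : ℝ | f X + b * β * z ∈ B} :=
    (show Measurable fun z : ℝ => f X + b * β * z by fun_prop) hB
  have hm : Measurable fun p : ℝ × ℝ => f X + (p.1 + b * β * p.2) := by fun_prop
  have hG : (gaussianMechanism f (2 * b ^ 2 * L) X).real B =
      (gaussianReal 0 1).real {z | f X + b * β * z ∈ B} := by
    have hv : gaussianReal 0 (2 * b ^ 2 * L).toNNReal =
        (gaussianReal 0 1).map fun z => b * β * z := by
      rw [gaussianReal_map_const_mul, mul_zero]
      congr 1
      ext
      simp only [NNReal.coe_mk, mul_one]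
      rw [Real.coe_toNNReal _ (by positivity), mul_pow, hβ2]
      ring
    rw [gaussianMechanism, hv, Measure.map_map (by fun_prop) (by fun_prop),
      map_measureReal_apply (by fun_prop) hB]
    rfl
  set q : ℝ → ℝ := fun t => (laplaceMeasure 0 b).real {ξ | f X + (ξ + b * β * t) ∈ B} with hq
  have hqm : Measurable q := (measurable_measure_prodMk_right (hm hB)).ennreal_toReal
  have hH : ((laplaceMechanism f b).followedBy (samplerKernel (2 * L + 1) (b * β) k) X).real B =
      ∫ t, q t ∂(samplerLaw (2 * L + 1) k) := by
    rw [laplace_followedBy_samplerKernel f ha hb, map_measureReal_apply hm hB, Measure.real,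
      Measure.prod_apply_symm (hm hB)]
    exact (integral_toReal (measurable_measure_prodMk_right (hm hB)).aemeasurable
      (ae_of_all _ fun t => measure_lt_top _ _)).symm
  have hid : ∫ t, q t * (1 - t ^ 2 / (2 * L + 1)) ∂(gaussianReal 0 1) =
      (1 - 1 / (2 * L + 1)) * (gaussianReal 0 1).real {z | f X + b * β * z ∈ B} := by
    have h := integral_laplace_smoothing hβ hC
    simp_rw [← laplaceMeasure_real_scaled hb hβ (f X) _ hB, hβ2] at h
    have h' (t : ℝ) : q t * (1 - t ^ 2 / (2 * L + 1)) =
        (2 * L + 1)⁻¹ * (q t * (2 * L + 1 - t ^ 2)) := by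
      field_simp
    simp_rw [h']
    rw [integral_const_mul, h]
    field_simp
    ring
  rw [hH, hG]
  refine (abs_integral_samplerLaw_sub_le (by linarith) hqm (fun t => measureReal_nonneg)
    (fun t => measureReal_le_one) measureReal_nonneg measureReal_le_one hid k).trans ?_
  linarith [integral_negPart_le hL]

/-! ### Privacy and accuracy -/

theorem isDifferentiallyPrivate_laplace_followedBy {𝒳 : Type*} {n : ℕ} (f : (Fin n → 𝒳) → ℝ)
    {b : ℝ} (hb : 0 < b) (K : Kernel ℝ ℝ) [IsMarkovKernel K] (hf : FiniteSensitivity f) :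
    IsDifferentiallyPrivate ((laplaceMechanism f b).followedBy K) (sensitivity f / b) 0 := by
  intro X Y hXY B hB
  have hlap (Z : Fin n → 𝒳) : laplaceMechanism f b Z = laplaceMeasure (f Z) b :=
    laplaceMeasure_map_add _ _
  have hprob (Z : Fin n → 𝒳) : IsProbabilityMeasure (laplaceMechanism f b Z) := by
    have := isProbabilityMeasure_laplaceMeasure hb
    exact Measure.isProbabilityMeasure_map (by fun_prop)
  have := hprob Y
  have hle : |f X - f Y| ≤ sensitivity f := le_csSup hf ⟨X, Y, hXY, rfl⟩
  have h : (laplaceMechanism f b).followedBy K X B ≤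
      ENNReal.ofReal (Real.exp (sensitivity f / b)) * (laplaceMechanism f b).followedBy K Y B := by
    simp only [Mechanism.followedBy]
    rw [Measure.bind_apply hB K.aemeasurable, Measure.bind_apply hB K.aemeasurable,
      ← smul_eq_mul, ← lintegral_smul_measure, hlap, hlap]
    exact lintegral_mono' (laplaceMeasure_le hb hle) le_rfl
  have hfin : (laplaceMechanism f b).followedBy K Y B ≠ ⊤ := by
    have : IsProbabilityMeasure ((laplaceMechanism f b).followedBy K Y) :=
      inferInstanceAs (IsProbabilityMeasure (K ∘ₘ laplaceMechanism f b Y))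
    exact measure_ne_top _ _
  have h' := ENNReal.toReal_mono (ENNReal.mul_ne_top ENNReal.ofReal_ne_top hfin) h
  rw [ENNReal.toReal_mul, ENNReal.toReal_ofReal (Real.exp_pos _).le] at h'
  rw [add_zero]
  exact h'

theorem accuracy_sampler_le {𝒳 : Type*} {n : ℕ} (f : (Fin n → 𝒳) → ℝ) {a b : ℝ} (ha : 0 < a)
    (hb : 0 < b) (σ : ℝ) (k : ℕ) :
    accuracy ((laplaceMechanism f b).followedBy (samplerKernel a σ k)) f ≤
      ENNReal.ofReal √(2 * b ^ 2 + σ ^ 2) := by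
  have := isProbabilityMeasure_samplerLaw ha k
  have := isProbabilityMeasure_laplaceMeasure hb
  refine iSup_le fun X => ?_
  have h : ∫⁻ y, ENNReal.ofReal ((y - f X) ^ 2)
      ∂((laplaceMechanism f b).followedBy (samplerKernel a σ k) X) ≤
      ENNReal.ofReal (2 * b ^ 2 + σ ^ 2) := by
    rw [laplace_followedBy_samplerKernel f ha hb, lintegral_map (by fun_prop) (by fun_prop),
      lintegral_prod_symm _ (by fun_prop)]
    -- The Laplace noise is integrated first, with the sampler value t fixed.
    simp only [add_sub_cancel_left, lintegral_sq_add_laplaceMeasure hb]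
    have hsplit (t : ℝ) : ENNReal.ofReal (2 * b ^ 2 + (σ * t) ^ 2) =
        ENNReal.ofReal (2 * b ^ 2) + ENNReal.ofReal (σ ^ 2) * ENNReal.ofReal (t ^ 2) := by
      rw [← ENNReal.ofReal_mul (sq_nonneg _), ← ENNReal.ofReal_add (by positivity) (by positivity),
        mul_pow]
    simp_rw [hsplit]
    rw [lintegral_add_left (by fun_prop), lintegral_const_mul _ (by fun_prop), lintegral_const,
      measure_univ, mul_one, ENNReal.ofReal_add (by positivity) (by positivity)]
    gcongr
    exact mul_le_of_le_one_right' (lintegral_sq_samplerLaw_le ha k)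
  calc _ ≤ ENNReal.ofReal (2 * b ^ 2 + σ ^ 2) ^ (1 / 2 : ℝ) :=
        ENNReal.rpow_le_rpow h (by norm_num)
    _ = ENNReal.ofReal √(2 * b ^ 2 + σ ^ 2) := by
        rw [ENNReal.ofReal_rpow_of_nonneg (by positivity) (by norm_num), Real.sqrt_eq_rpow]

/-! ### Constants in δ, and the assembly -/

theorem two_le_log_twelve_div {δ : ℝ} (hδ : 0 < δ) (hδ1 : δ < 1) : 2 ≤ Real.log (12 / δ) := by
  rw [Real.le_log_iff_exp_le (by positivity), le_div_iff₀ hδ]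
  have h1 := Real.exp_one_lt_d9
  have h2 : Real.exp 2 = Real.exp 1 * Real.exp 1 := by rw [← Real.exp_add]; norm_num
  nlinarith [Real.exp_pos 1, Real.exp_pos 2]

theorem pow_rounds_le {δ : ℝ} (hδ : 0 < δ) : (1 / 5 : ℝ) ^ rounds δ ≤ δ / 12 := by
  have h1 : 12 / δ ≤ rounds δ := by
    rw [rounds]; push_cast; exact (Nat.lt_floor_add_one _).le
  have h2 : (rounds δ : ℝ) ≤ 5 ^ rounds δ := by
    exact_mod_cast (Nat.lt_pow_self (by norm_num : 1 < 5)).le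
  rw [one_div, inv_pow, ← inv_div]
  exact inv_anti₀ (by positivity) (h1.trans h2)

theorem rejectionProgram_samplesWithin {δ : ℝ} (hδ : 0 < δ) (hδ1 : δ < 1) (b x : ℝ) :
    rejectionProgram.SamplesWithin [δ, b, x]
      (samplerKernel (2 * Real.log (12 / δ) + 1) (b * √(2 * Real.log (12 / δ))) (rounds δ) x)
      (108 * (1 / δ) + 19) := by
  have ha : 0 < 2 * Real.log (12 / δ) + 1 := by linarith [two_le_log_twelve_div hδ hδ1]
  have hm := measurable_lastAccepted (2 * Real.log (12 / δ) + 1) (rounds δ)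
  refine ⟨fun ω => x + b * √(2 * Real.log (12 / δ)) *
    lastAccepted (2 * Real.log (12 / δ) + 1) ω (rounds δ), by fun_prop,
    rejectionProgram_halts δ b x hδ, ?_⟩
  rw [samplerKernel_apply ha, ← tapeLaw_map_lastAccepted ha, Measure.map_map (by fun_prop) hm]
  rfl

end LaplaceToGauss

theorem corollary3 :
    ∃ (P : LaplaceToGauss.Program) (p : Polynomial ℝ),
      ∀ b δ : ℝ, 0 < b → 0 < δ → δ < 1 →
        ∃ K : ProbabilityTheory.Kernel ℝ ℝ, ProbabilityTheory.IsMarkovKernel K ∧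
          (∀ x : ℝ, P.SamplesWithin [δ, b, x] (K x) (p.eval (1 / δ))) ∧
          ∀ (𝒳 : Type*) (n : ℕ) (f : (Fin n → 𝒳) → ℝ),
            (∀ X : Fin n → 𝒳,
              LaplaceToGauss.tvDist
                ((LaplaceToGauss.laplaceMechanism f b).followedBy K X)
                (LaplaceToGauss.gaussianMechanism f (2 * b ^ 2 * Real.log (12 / δ)) X) ≤ δ) ∧
            (LaplaceToGauss.FiniteSensitivity f →
              LaplaceToGauss.IsDifferentiallyPrivate
                ((LaplaceToGauss.laplaceMechanism f b).followedBy K)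
                (LaplaceToGauss.sensitivity f / b) 0) ∧
            LaplaceToGauss.accuracy ((LaplaceToGauss.laplaceMechanism f b).followedBy K) f ≤
              ENNReal.ofReal (Real.sqrt (2 * b ^ 2 * Real.log (12 / δ) + 2 * b ^ 2
                + b ^ 2 / 4 * δ * Real.log (12 / δ) ^ (3 / 2 : ℝ))) := by
  refine ⟨LaplaceToGauss.rejectionProgram, .C 108 * .X + .C 19, fun b δ hb hδ hδ1 => ?_⟩
  have hL := LaplaceToGauss.two_le_log_twelve_div hδ hδ1
  have ha : 0 < 2 * Real.log (12 / δ) + 1 := by linarith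
  have hK := LaplaceToGauss.isMarkovKernel_samplerKernel ha (b * √(2 * Real.log (12 / δ)))
    (LaplaceToGauss.rounds δ)
  refine ⟨_, hK, fun x => ?_, fun 𝒳 n f => ⟨fun X => ?_, fun hf => ?_, ?_⟩⟩
  · simpa using LaplaceToGauss.rejectionProgram_samplesWithin hδ hδ1 b x
  · refine (LaplaceToGauss.tvDist_sampler_le f hb hL _ X).trans ?_
    rw [Real.exp_neg, Real.exp_log (by positivity), inv_div]
    linarith [LaplaceToGauss.pow_rounds_le hδ]
  · exact LaplaceToGauss.isDifferentiallyPrivate_laplace_followedBy f hb _ hf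
  · refine (LaplaceToGauss.accuracy_sampler_le f ha hb _ _).trans
      (ENNReal.ofReal_le_ofReal (Real.sqrt_le_sqrt ?_))
    rw [mul_pow, Real.sq_sqrt (by linarith)]
    -- The sampler already meets the bound without this term, so its nonnegativity is enough.
    have : 0 ≤ b ^ 2 / 4 * δ * Real.log (12 / δ) ^ (3 / 2 : ℝ) := by positivity
    linarith
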